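/- Let $\Bbbk$ be a field of characteristic zero and let $B=\Bbbk\langle a,b,c\mid a^2,\,b^2,\,c^2,\,ab+bc+ca,\,ba+ac+cb\rangle$ be the $12$-dimensional Fomin–Kirillov algebra. Let $A=\Bbbk[a,b]\subset B$ be the subalgebra generated by $a,b$; it has the basis $1,a,b,ab,ba,aba$ (and $aba=bab$). Let $R=\Bbbk[c]/(c^2)$, identified with the subalgebra of $B$ generated by $c$, and let $A_+$ be the augmentation ideal of $A$. Multiplication $R\otimes A\to B$ is bijective, so there are unique linear maps $\alpha',\beta':A\to A$ with $u\,c=\alpha'(u)+c\,\beta'(u)$ in $B$ for all $u\in A$; both preserve $A_+$. Let $V=(A_+)^*$ and let $E(A)=\operatorname{Ext}_A^*(\Bbbk,\Bbbk)$, with the Yoneda product, be the cohomology ring of the normalized bar complex, i.e. of the tensor algebra $T(V)$ with the graded derivation $\delta$ given on $V$ by $\delta f=-\sum_i f_i'\otimes f_i''$, where $f(uv)=\sum_i f_i'(u)f_i''(v)$ for $u,v\in A_+$. The algebra $R$ acts on $E(A)$ through the action on the complex $T(V)$ given by $$c\cdot(f_1\otimes\cdots\otimes f_q)=\sum_{i=1}^q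 f_1\otimes\cdots\otimes f_{i-1}\otimes f_i\alpha'\otimes f_{i+1}\beta'\otimes\cdots\otimes f_q\beta',$$ and $f_1\otimes\cdots\otimes f_q\mapsto f_1\beta'\otimes\cdots\otimes f_q\beta'$ induces an algebra endomorphism $\beta$ of $E(A)$. Let $p_a,p_b,p_{ab},p_{ba},p_{aba}$ be the basis of $V$ dual to $a,b,ab,ba,aba$, and let $x,y\in E_1(A)$ and $z\in E_2(A)$ be the classes of $p_a$, $p_b$ and $p_b\otimes p_{ab}+p_{ba}\otimes p_b$. Then: 1. $c\cdot x=c\cdot y=0$ and $c\cdot z=x^2-y^2$. 2. These values determine the action: one has $c\cdot(vw)=v\,(c\cdot w)+(c\cdot v)\,\beta(w)$ for all $v,w\in E(A)$, and every $\Bbbk$-linear map $D:E(A)\to E(A)$ such that $D(vw)=v\,D(w)+D(v)\,\beta(w)$ for all $v,w\in E(A)$, $D(x)=D(y)=0$ and $D(z)=x^2-y^2$ is the action of $c$. 3. For $t\in\{x,y\}$ and all integers $l,n\ge 0$, $$c\cdot(t^l z^{2n})=0\qquad\text{and}\qquad c\cdot(t^l z^{2n+1})=t^l(x^2-y^2)z^{2n}.$$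 -/

import Mathlib

noncomputable section

namespace FominKirillov

open TensorProduct

/-- Defining relations of the `12`-dimensional Fomin-Kirillov algebra; the generators
`0, 1, 2` are `a, b, c`. -/
inductive Rel (k : Type*) [Field k] : FreeAlgebra k (Fin 3) → FreeAlgebra k (Fin 3) → Prop
  | sq (i : Fin 3) : Rel k (FreeAlgebra.ι k i * FreeAlgebra.ι k i) 0
  | cyc₁ : Rel k (FreeAlgebra.ι k 0 * FreeAlgebra.ι k 1 + FreeAlgebra.ι k 1 * FreeAlgebra.ι k 2
      + FreeAlgebra.ι k 2 * FreeAlgebra.ι k 0) 0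
  | cyc₂ : Rel k (FreeAlgebra.ι k 1 * FreeAlgebra.ι k 0 + FreeAlgebra.ι k 0 * FreeAlgebra.ι k 2
      + FreeAlgebra.ι k 2 * FreeAlgebra.ι k 1) 0

/-- The Fomin-Kirillov algebra
`B = k⟨a, b, c | a², b², c², ab + bc + ca, ba + ac + cb⟩`. -/
def B (k : Type*) [Field k] : Type _ := RingQuot (Rel k)

variable (k : Type*) [Field k]

instance : Ring (B k) := inferInstanceAs (Ring (RingQuot (Rel k)))
instance : Algebra k (B k) := inferInstanceAs (Algebra k (RingQuot (Rel k)))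

/-- The quotient map from the free algebra to `B`. -/
def mkB : FreeAlgebra k (Fin 3) →ₐ[k] B k := RingQuot.mkAlgHom k (Rel k)

lemma mkB_rel {x y : FreeAlgebra k (Fin 3)} (h : Rel k x y) : mkB k x = mkB k y :=
  RingQuot.mkAlgHom_rel k h

lemma mkB_surjective : Function.Surjective (mkB k) := RingQuot.mkAlgHom_surjective k (Rel k)

/-- The generators `a, b, c` of `B`. -/
def gen (i : Fin 3) : B k := mkB k (FreeAlgebra.ι k i)

lemma gen_sq (i : Fin 3) : gen k i * gen k i = 0 := by
  simpa [gen] using mkB_rel k (Rel.sq (k := k) i)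

lemma gen_cyc₁ : gen k 0 * gen k 1 + gen k 1 * gen k 2 + gen k 2 * gen k 0 = 0 := by
  simpa [gen] using mkB_rel k (Rel.cyc₁ (k := k))

lemma gen_cyc₂ : gen k 1 * gen k 0 + gen k 0 * gen k 2 + gen k 2 * gen k 1 = 0 := by
  simpa [gen] using mkB_rel k (Rel.cyc₂ (k := k))

variable {k} in
/-- Universal property of `B`. -/
def liftB {S : Type*} [Ring S] [Algebra k S] (g : Fin 3 → S) (hsq : ∀ i, g i * g i = 0)
    (h₁ : g 0 * g 1 + g 1 * g 2 + g 2 * g 0 = 0)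
    (h₂ : g 1 * g 0 + g 0 * g 2 + g 2 * g 1 = 0) : B k →ₐ[k] S :=
  (RingQuot.liftAlgHom k ⟨FreeAlgebra.lift k g, by
    intro x y h
    cases h with
    | sq i => simpa using hsq i
    | cyc₁ => simpa using h₁
    | cyc₂ => simpa using h₂⟩ : RingQuot (Rel k) →ₐ[k] S)

lemma liftB_gen {S : Type*} [Ring S] [Algebra k S] (g : Fin 3 → S) (hsq : ∀ i, g i * g i = 0)
    (h₁ : g 0 * g 1 + g 1 * g 2 + g 2 * g 0 = 0)
    (h₂ : g 1 * g 0 + g 0 * g 2 + g 2 * g 1 = 0) (i : Fin 3) :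
    liftB g hsq h₁ h₂ (gen k i) = g i :=
  (RingQuot.liftAlgHom_mkAlgHom_apply k _ _ _).trans (FreeAlgebra.lift_ι_apply _ _)

/-- The subalgebra `A = k[a, b]` of `B`. -/
def A : Subalgebra k (B k) := Algebra.adjoin k {gen k 0, gen k 1}

/-- The generator `a` of `A`. -/
def genA : A k := ⟨gen k 0, Algebra.subset_adjoin (by simp)⟩

/-- The generator `b` of `A`. -/
def genB : A k := ⟨gen k 1, Algebra.subset_adjoin (by simp)⟩

/-- The algebra `R = k[c]/(c²)`. -/
abbrev R : Type _ := DualNumber k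

/-- The generator `c` of `R`. -/
def c : R k := DualNumber.eps

/-- The augmentation of `B`. -/
def augB : B k →ₐ[k] k := liftB (fun _ => 0) (by simp) (by simp) (by simp)

/-- The augmentation of `A`. -/
def aug : A k →ₐ[k] k := (augB k).comp (A k).val

/-- The augmentation ideal `A₊` of `A` (the span of the elements of positive degree). -/
def Aplus : Submodule k (A k) := LinearMap.ker (aug k).toLinearMap

lemma mem_Aplus (x : A k) : x ∈ Aplus k ↔ aug k x = 0 := Iff.rfl

lemma aug_genA : aug k (genA k) = 0 := by simp [aug, genA, augB, liftB_gen]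
lemma aug_genB : aug k (genB k) = 0 := by simp [aug, genB, augB, liftB_gen]

/-! ### The basis `1, a, b, ab, ba, aba` of `A` -/

lemma genA_sq : genA k * genA k = 0 := Subtype.ext (gen_sq k 0)
lemma genB_sq : genB k * genB k = 0 := Subtype.ext (gen_sq k 1)

lemma gen_braid : gen k 0 * gen k 1 * gen k 0 = gen k 1 * gen k 0 * gen k 1 := by
  have h1 : gen k 0 * (gen k 1 * gen k 0 + gen k 0 * gen k 2 + gen k 2 * gen k 1) = 0 := by
    rw [gen_cyc₂, mul_zero]
  have h2 : (gen k 1 * gen k 0 + gen k 0 * gen k 2 + gen k 2 * gen k 1) * gen k 1 = 0 := by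
    rw [gen_cyc₂, zero_mul]
  have e1 : gen k 0 * (gen k 0 * gen k 2) = 0 := by rw [← mul_assoc, gen_sq, zero_mul]
  have e2 : (gen k 2 * gen k 1) * gen k 1 = 0 := by rw [mul_assoc, gen_sq, mul_zero]
  rw [mul_add, mul_add, e1, add_zero] at h1
  rw [add_mul, add_mul, e2, add_zero] at h2
  rw [mul_assoc (gen k 0) (gen k 2)] at h2
  rw [mul_assoc, eq_neg_of_add_eq_zero_left h1, eq_neg_of_add_eq_zero_left h2]

lemma braid : genA k * genB k * genA k = genB k * genA k * genB k := Subtype.ext (gen_braid k)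

/-- The monomials `1, a, b, ab, ba, aba`. -/
def mon : Fin 6 → A k :=
  ![1, genA k, genB k, genA k * genB k, genB k * genA k, genA k * genB k * genA k]

/-- Left multiplication by `a` in the monomials. -/
def matA : Matrix (Fin 6) (Fin 6) k :=
  !![0,0,0,0,0,0; 1,0,0,0,0,0; 0,0,0,0,0,0; 0,0,1,0,0,0; 0,0,0,0,0,0; 0,0,0,0,1,0]

/-- Left multiplication by `b` in the monomials. -/
def matB : Matrix (Fin 6) (Fin 6) k :=
  !![0,0,0,0,0,0; 0,0,0,0,0,0; 1,0,0,0,0,0; 0,0,0,0,0,0; 0,1,0,0,0,0; 0,0,0,1,0,0]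

lemma matA_sq : matA k * matA k = 0 := by
  ext i j; fin_cases i <;> fin_cases j <;> simp [matA, Matrix.mul_apply, Fin.sum_univ_succ]
lemma matB_sq : matB k * matB k = 0 := by
  ext i j; fin_cases i <;> fin_cases j <;> simp [matB, Matrix.mul_apply, Fin.sum_univ_succ]
lemma matA_sq_mul (X : Matrix (Fin 6) (Fin 6) k) : matA k * (matA k * X) = 0 := by
  rw [← mul_assoc, matA_sq, zero_mul]
lemma matB_sq_mul (X : Matrix (Fin 6) (Fin 6) k) : matB k * (matB k * X) = 0 := by
  rw [← mul_assoc, matB_sq, zero_mul]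
lemma mat_braid : matA k * matB k * matA k = matB k * matA k * matB k := by
  ext i j
  fin_cases i <;> fin_cases j <;> simp [matA, matB, Matrix.mul_apply, Fin.sum_univ_succ]

/-- The left regular representation of `B = A ⊕ cA`. -/
def regRep : B k →ₐ[k] Matrix (Fin 2) (Fin 2) (Matrix (Fin 6) (Fin 6) k) :=
  liftB ![!![matA k, -(matB k * matA k); 0, -matB k], !![matB k, -(matA k * matB k); 0, -matA k],
      !![0, 0; 1, 0]]
    (by
      have h := mat_braid k
      intro i
      fin_cases i <;> ext1 p q <;> fin_cases p <;> fin_cases q <;>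
        simp [Matrix.mul_apply, Fin.sum_univ_two, matA_sq, matB_sq, ← mul_assoc, h])
    (by ext1 p q; fin_cases p <;> fin_cases q <;> simp [mul_assoc, matA_sq, matA_sq_mul])
    (by ext1 p q; fin_cases p <;> fin_cases q <;> simp [mul_assoc, matB_sq, matB_sq_mul])

/-- The coordinates, in the basis `1, a, b, ab, ba, aba` of `A`, of `x` (for `i = 0`) and of `y`
(for `i = 1`), where the given element of `B = A ⊕ cA` is `x + c y`. -/
def coordB (i : Fin 2) : B k →ₗ[k] (Fin 6 → k) where
  toFun x j := regRep k x i 0 j 0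
  map_add' x y := by ext j; simp
  map_smul' r x := by ext j; simp

lemma span_mon : Submodule.span k (Set.range (mon k)) = ⊤ := by
  set S := Submodule.span k (Set.range (mon k)) with hS
  have hmem (i : Fin 6) : mon k i ∈ S := Submodule.subset_span ⟨i, rfl⟩
  have hA : ∀ y ∈ S, genA k * y ∈ S := by
    intro y hy
    induction hy using Submodule.span_induction with
    | zero => simp
    | add u v _ _ hu hv => rw [mul_add]; exact S.add_mem hu hv
    | smul r u _ hu => rw [mul_smul_comm]; exact S.smul_mem r hu
    | mem u hu =>
      obtain ⟨i, rfl⟩ := hu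
      fin_cases i
      · simpa [mon] using hmem 1
      · simp [mon, genA_sq]
      · simpa [mon] using hmem 3
      · simp [mon, ← mul_assoc, genA_sq]
      · simpa [mon, mul_assoc] using hmem 5
      · simp [mon, ← mul_assoc, genA_sq]
  have hB : ∀ y ∈ S, genB k * y ∈ S := by
    intro y hy
    induction hy using Submodule.span_induction with
    | zero => simp
    | add u v _ _ hu hv => rw [mul_add]; exact S.add_mem hu hv
    | smul r u _ hu => rw [mul_smul_comm]; exact S.smul_mem r hu
    | mem u hu =>
      obtain ⟨i, rfl⟩ := hu
      fin_cases i
      · simpa [mon] using hmem 2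
      · simpa [mon] using hmem 4
      · simp [mon, genB_sq]
      · simpa [mon, ← mul_assoc, braid] using hmem 5
      · simp [mon, ← mul_assoc, genB_sq]
      · simp [mon, braid, ← mul_assoc, genB_sq]
  have hall : ∀ x (hx : x ∈ A k), ∀ y ∈ S, (⟨x, hx⟩ : A k) * y ∈ S := by
    intro x hx
    induction hx using Algebra.adjoin_induction with
    | mem u hu =>
      rcases hu with rfl | rfl
      · exact hA
      · exact hB
    | algebraMap r =>
      intro y hy
      have : (⟨algebraMap k (B k) r, (A k).algebraMap_mem r⟩ : A k) * y = r • y := by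
        rw [Algebra.smul_def]; rfl
      exact this ▸ S.smul_mem r hy
    | add u v hu hv iu iv =>
      intro y hy
      have := S.add_mem (iu y hy) (iv y hy)
      rwa [← add_mul] at this
    | mul u v hu hv iu iv =>
      intro y hy
      have := iu _ (iv y hy)
      rwa [← mul_assoc] at this
  refine eq_top_iff.2 fun x _ => ?_
  simpa [mon] using hall x.1 x.2 _ (hmem 0)

lemma regRep_a : regRep k (gen k 0) = !![matA k, -(matB k * matA k); 0, -matB k] := by
  rw [regRep, liftB_gen]; rfl
lemma regRep_b : regRep k (gen k 1) = !![matB k, -(matA k * matB k); 0, -matA k] := by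
  rw [regRep, liftB_gen]; rfl
lemma regRep_c : regRep k (gen k 2) = !![0, 0; 1, 0] := by
  rw [regRep, liftB_gen]; rfl

lemma coordB_mon (i : Fin 6) : coordB k 0 (mon k i : B k) = Pi.single i 1 := by
  ext j
  fin_cases i <;> fin_cases j <;>
    simp [coordB, mon, genA, genB, regRep_a, regRep_b, Matrix.mul_apply, Fin.sum_univ_succ,
      matA, matB]

/-- The basis `1, a, b, ab, ba, aba` of `A`. -/
def basisA : Module.Basis (Fin 6) k (A k) :=
  Module.Basis.mk (v := mon k)
    (by
      refine LinearIndependent.of_comp ((coordB k 0).comp (A k).val.toLinearMap) ?_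
      have : ⇑((coordB k 0).comp (A k).val.toLinearMap) ∘ mon k = Pi.basisFun k (Fin 6) := by
        ext1 i
        simpa using coordB_mon k i
      rw [this]
      exact (Pi.basisFun k (Fin 6)).linearIndependent)
    (span_mon k).ge

lemma basisA_apply (i : Fin 6) : basisA k i = mon k i := by simp [basisA]

instance : Module.Finite k (A k) := Module.Finite.of_basis (basisA k)

lemma coordB_basisA (x : A k) (i : Fin 6) : (basisA k).repr x i = coordB k 0 (x : B k) i := by
  have : (Finsupp.lapply i).comp (basisA k).repr.toLinearMap =
      (LinearMap.proj i).comp ((coordB k 0).comp (A k).val.toLinearMap) := by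
    refine (basisA k).ext fun j => ?_
    have := congrFun (coordB_mon k j) i
    simp only [LinearMap.comp_apply, LinearEquiv.coe_coe, Module.Basis.repr_self,
      Finsupp.lapply_apply, LinearMap.proj_apply]
    rw [basisA_apply]
    simp [this, Finsupp.single_apply, Pi.single_apply, eq_comm]
  exact DFunLike.congr_fun this x

/-! ### The twisting map

Multiplication gives bijections `A ⊗ R → B` and `R ⊗ A → B`; the composite
`τ : A ⊗ R → R ⊗ A` is the inverse of the twisting map. In the basis `1, c` of `R` it is given by
`τ (x ⊗ c) = 1 ⊗ α' x + c ⊗ β' x`. -/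

/-- The multiplication map `R ⊗ A → B`, where `1 ⊗ x + c ⊗ y` is written as `(x, y)`. -/
def mulRA : A k × A k →ₗ[k] B k where
  toFun p := (p.1 : B k) + gen k 2 * p.2
  map_add' p q := by simp [mul_add]; abel
  map_smul' r p := by simp

lemma mulRA_apply (x y : A k) : mulRA k (x, y) = (x : B k) + gen k 2 * y := rfl

lemma regRep_A (x : A k) : regRep k (x : B k) 1 0 = 0 := by
  obtain ⟨x, hx⟩ := x
  induction hx using Algebra.adjoin_induction with
  | mem u hu => rcases hu with rfl | rfl <;> simp [regRep_a, regRep_b]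
  | algebraMap r => simp [Matrix.algebraMap_matrix_apply]
  | add u v hu hv iu iv => simp_all
  | mul u v hu hv iu iv => simp_all [Matrix.mul_apply, Fin.sum_univ_two]

lemma coordB_zero_c_mul (x : B k) : coordB k 0 (gen k 2 * x) = 0 := by
  ext j; simp [coordB, regRep_c, Matrix.mul_apply, Fin.sum_univ_two]

lemma coordB_one_c_mul (x : B k) : coordB k 1 (gen k 2 * x) = coordB k 0 x := by
  ext j; simp [coordB, regRep_c, Matrix.mul_apply, Fin.sum_univ_two]

lemma coordB_one_A (x : A k) : coordB k 1 (x : B k) = 0 := by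
  ext j; simp [coordB, regRep_A]

lemma eq_zero_of_coordB (x : A k) (h : coordB k 0 (x : B k) = 0) : x = 0 := by
  refine (basisA k).ext_elem fun i => ?_
  simp [coordB_basisA, h]

lemma mulRA_injective : Function.Injective (mulRA k) := by
  refine (injective_iff_map_eq_zero _).2 ?_
  rintro ⟨x, y⟩ h
  rw [mulRA_apply] at h
  have h0 := congrArg (coordB k 0) h
  have h1 := congrArg (coordB k 1) h
  rw [map_add, coordB_zero_c_mul, add_zero, map_zero] at h0
  rw [map_add, coordB_one_c_mul, coordB_one_A, zero_add, map_zero] at h1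
  rw [eq_zero_of_coordB k x h0, eq_zero_of_coordB k y h1]
  rfl

lemma B_induction {p : B k → Prop} (hr : ∀ r, p (algebraMap k (B k) r)) (hg : ∀ i, p (gen k i))
    (hadd : ∀ x y, p x → p y → p (x + y)) (hmul : ∀ x y, p x → p y → p (x * y)) (x : B k) :
    p x := by
  obtain ⟨x, rfl⟩ := mkB_surjective k x
  induction x using FreeAlgebra.induction with
  | grade0 r => simpa using hr r
  | grade1 i => exact hg i
  | mul u v hu hv => rw [map_mul]; exact hmul _ _ hu hv
  | add u v hu hv => rw [map_add]; exact hadd _ _ hu hv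

lemma gen_a_c : gen k 0 * gen k 2 = -(gen k 1 * gen k 0) - gen k 2 * gen k 1 := by
  rw [sub_eq_add_neg, ← neg_add, eq_neg_iff_add_eq_zero, ← gen_cyc₂ k]
  abel

lemma gen_b_c : gen k 1 * gen k 2 = -(gen k 0 * gen k 1) - gen k 2 * gen k 0 := by
  rw [sub_eq_add_neg, ← neg_add, eq_neg_iff_add_eq_zero, ← gen_cyc₁ k]
  abel

lemma mulRA_surjective : Function.Surjective (mulRA k) := by
  have key : ∀ x y : B k, y ∈ LinearMap.range (mulRA k) → x * y ∈ LinearMap.range (mulRA k) := by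
    intro x
    induction x using B_induction with
    | hr r =>
      intro y hy
      rw [← Algebra.smul_def]
      exact Submodule.smul_mem _ r hy
    | hg i =>
      rintro _ ⟨⟨x, y⟩, rfl⟩
      rw [mulRA_apply]
      fin_cases i
      · refine ⟨(genA k * x - genB k * genA k * y, -(genB k * y)), ?_⟩
        have h : _ * (y : B k) = _ * (y : B k) := congrArg (· * (y : B k)) (gen_a_c k)
        rw [sub_mul, neg_mul] at h
        simp only [mulRA_apply, genA, genB, Fin.zero_eta, mul_add, ← mul_assoc, h]
        push_cast
        simp only [mul_neg, ← mul_assoc]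
        abel
      · refine ⟨(genB k * x - genA k * genB k * y, -(genA k * y)), ?_⟩
        have h : _ * (y : B k) = _ * (y : B k) := congrArg (· * (y : B k)) (gen_b_c k)
        rw [sub_mul, neg_mul] at h
        simp only [mulRA_apply, genA, genB, Fin.mk_one, mul_add, ← mul_assoc, h]
        push_cast
        simp only [mul_neg, ← mul_assoc]
        abel
      · refine ⟨(0, x), ?_⟩
        simp [mulRA_apply, mul_add, ← mul_assoc, gen_sq]
    | hadd u v hu hv =>
      intro y hy
      rw [add_mul]
      exact Submodule.add_mem _ (hu y hy) (hv y hy)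
    | hmul u v hu hv =>
      intro y hy
      rw [mul_assoc]
      exact hu _ (hv y hy)
  intro x
  have h1 : (1 : B k) ∈ LinearMap.range (mulRA k) := ⟨(1, 0), by simp [mulRA_apply]⟩
  simpa using key x 1 h1

/-- The bijection `R ⊗ A ≃ B` given by multiplication. -/
def mulRAEquiv : (A k × A k) ≃ₗ[k] B k :=
  LinearEquiv.ofBijective (mulRA k) ⟨mulRA_injective k, mulRA_surjective k⟩

/-- The component `α'` of the inverse twisting map. -/
def twα : A k →ₗ[k] A k :=
  LinearMap.fst k _ _ ∘ₗ (mulRAEquiv k).symm.toLinearMap ∘ₗ LinearMap.mulRight k (gen k 2) ∘ₗ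
    (A k).val.toLinearMap

/-- The component `β'` of the inverse twisting map. -/
def twβ : A k →ₗ[k] A k :=
  LinearMap.snd k _ _ ∘ₗ (mulRAEquiv k).symm.toLinearMap ∘ₗ LinearMap.mulRight k (gen k 2) ∘ₗ
    (A k).val.toLinearMap

/-- The defining property `x c = α' x + c (β' x)` of `α'` and `β'`. -/
lemma mul_c_eq (x : A k) : (x : B k) * gen k 2 = (twα k x : B k) + gen k 2 * (twβ k x : B k) :=
  ((mulRAEquiv k).apply_symm_apply ((x : B k) * gen k 2)).symm

lemma mulRA_unique {x y x' y' : A k}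
    (h : (x : B k) + gen k 2 * y = (x' : B k) + gen k 2 * y') : x = x' ∧ y = y' := by
  have := mulRA_injective k (a₁ := (x, y)) (a₂ := (x', y')) h
  simpa using this

lemma tw_mul (x y : A k) :
    twα k (x * y) = x * twα k y + twα k x * twβ k y ∧ twβ k (x * y) = twβ k x * twβ k y := by
  refine mulRA_unique k ?_
  rw [← mul_c_eq]
  push_cast
  rw [mul_assoc, mul_c_eq, mul_add, ← mul_assoc, mul_c_eq]
  noncomm_ring

lemma tw_sq (x : A k) :
    twα k (twα k x) = 0 ∧ twβ k (twα k x) + twα k (twβ k x) = 0 := by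
  refine mulRA_unique k ?_
  have h : (x : B k) * gen k 2 * gen k 2 = 0 := by rw [mul_assoc, gen_sq, mul_zero]
  rw [mul_c_eq, add_mul, mul_c_eq, mul_assoc, mul_c_eq, mul_add, ← mul_assoc (gen k 2) (gen k 2),
    gen_sq, zero_mul, add_zero] at h
  push_cast
  rw [zero_add, mul_zero, ← h]
  noncomm_ring

/-- The projection of `B` onto `R` with kernel generated by `a` and `b`. -/
def projR : B k →ₐ[k] R k := liftB ![0, 0, c k]
  (by intro i; fin_cases i <;> simp [c]) (by simp) (by simp)

lemma projR_A (x : A k) : projR k (x : B k) = algebraMap k (R k) (aug k x) := by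
  obtain ⟨x, hx⟩ := x
  induction hx using Algebra.adjoin_induction with
  | mem u hu => rcases hu with rfl | rfl <;> simp [projR, aug, augB, liftB_gen]
  | algebraMap r => simp [aug]
  | add u v hu hv iu iv =>
    change projR k (u + v) = algebraMap k _ (aug k (⟨u, hu⟩ + ⟨v, hv⟩))
    rw [map_add, map_add, map_add, iu, iv]
  | mul u v hu hv iu iv =>
    change projR k (u * v) = algebraMap k _ (aug k (⟨u, hu⟩ * ⟨v, hv⟩))
    rw [map_mul, map_mul, map_mul, iu, iv]

lemma aug_tw (x : A k) : aug k (twα k x) = 0 ∧ aug k (twβ k x) = aug k x := by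
  have h := congrArg (projR k) (mul_c_eq k x)
  rw [map_add, map_mul, map_mul, projR_A, projR_A, projR_A] at h
  have hc : projR k (gen k 2) = c k := by simp [projR, liftB_gen]
  rw [hc] at h
  have h0 := congrArg TrivSqZeroExt.fst h
  have h1 := congrArg TrivSqZeroExt.snd h
  simp [c, TrivSqZeroExt.algebraMap_eq_inl] at h0 h1
  exact ⟨h0.symm, h1.symm⟩

/-- The restriction of `α'` to `A₊`. -/
def twαPlus : Aplus k →ₗ[k] Aplus k :=
  (twα k).restrict fun x _ => (mem_Aplus k _).2 (aug_tw k x).1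

/-- The restriction of `β'` to `A₊`. -/
def twβPlus : Aplus k →ₗ[k] Aplus k :=
  (twβ k).restrict fun x hx => (mem_Aplus k _).2 ((aug_tw k x).2.trans hx)

/-- The multiplication `A₊ ⊗ A₊ → A₊`. -/
def mulPlus : Aplus k ⊗[k] Aplus k →ₗ[k] Aplus k :=
  TensorProduct.lift (LinearMap.mk₂ k
    (fun x y => ⟨x * y, by
      rw [mem_Aplus, map_mul, (mem_Aplus k _).1 x.2, zero_mul]⟩)
    (fun _ _ _ => Subtype.ext (add_mul _ _ _)) (fun _ _ _ => Subtype.ext (smul_mul_assoc _ _ _))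
    (fun _ _ _ => Subtype.ext (mul_add _ _ _)) (fun _ _ _ => Subtype.ext (mul_smul_comm _ _ _)))

lemma mulPlus_tmul (x y : Aplus k) : (mulPlus k (x ⊗ₜ y) : A k) = x * y := rfl

instance : Module.Finite k (Aplus k) := inferInstance

/-! ### Twisted derivations of tensor algebras -/

section SkewDer

variable {k} {M : Type*} [AddCommGroup M] [Module k M]
  (σ ρ : TensorAlgebra k M →ₐ[k] TensorAlgebra k M) (d : M →ₗ[k] TensorAlgebra k M)

/-- The algebra map `w ↦ !![σ w, D w; 0, ρ w]`, where `D` is the twisted derivation below. -/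
def skewHom : TensorAlgebra k M →ₐ[k] Matrix (Fin 2) (Fin 2) (TensorAlgebra k M) :=
  TensorAlgebra.lift k
    { toFun := fun f => !![σ (TensorAlgebra.ι k f), d f; 0, ρ (TensorAlgebra.ι k f)]
      map_add' := fun f g => by simp
      map_smul' := fun r f => by simp }

/-- The unique linear endomorphism `D` of the tensor algebra of `M` which extends `d` and satisfies
`D (v w) = σ v * D w + D v * ρ w` (see `skewDer_ι` and `skewDer_mul`). -/
def skewDer : TensorAlgebra k M →ₗ[k] TensorAlgebra k M where
  toFun w := skewHom σ ρ d w 0 1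
  map_add' v w := by simp
  map_smul' r w := by simp

lemma tensor_induction {p : TensorAlgebra k M → Prop} (h1 : p 1)
    (hι : ∀ f w, p w → p (TensorAlgebra.ι k f * w)) (hadd : ∀ v w, p v → p w → p (v + w))
    (hsmul : ∀ (r : k) v, p v → p (r • v)) (w : TensorAlgebra k M) : p w := by
  have key : ∀ v w : TensorAlgebra k M, p w → p (v * w) := by
    intro v
    induction v using TensorAlgebra.induction with
    | algebraMap r => intro w hw; rw [← Algebra.smul_def]; exact hsmul r w hw
    | ι f => exact hι f
    | mul a b ha hb => intro w hw; rw [mul_assoc]; exact ha _ (hb w hw)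
    | add a b ha hb => intro w hw; rw [add_mul]; exact hadd _ _ (ha w hw) (hb w hw)
  simpa using key w 1 h1

lemma skewHom_ι (f : M) : skewHom σ ρ d (TensorAlgebra.ι k f) =
    !![σ (TensorAlgebra.ι k f), d f; 0, ρ (TensorAlgebra.ι k f)] := by
  simp [skewHom]

lemma skewHom_eq (w : TensorAlgebra k M) :
    skewHom σ ρ d w 0 0 = σ w ∧ skewHom σ ρ d w 1 1 = ρ w ∧ skewHom σ ρ d w 1 0 = 0 := by
  induction w using tensor_induction with
  | h1 => simp
  | hι f w ih =>
    obtain ⟨h1, h2, h3⟩ := ih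
    simp [skewHom_ι, Matrix.mul_apply, Fin.sum_univ_two, h1, h2, h3]
  | hadd v w hv hw =>
    obtain ⟨h1, h2, h3⟩ := hv
    obtain ⟨h4, h5, h6⟩ := hw
    simp [h1, h2, h3, h4, h5, h6]
  | hsmul r v hv =>
    obtain ⟨h1, h2, h3⟩ := hv
    simp [h1, h2, h3]

lemma skewDer_ι (f : M) : skewDer σ ρ d (TensorAlgebra.ι k f) = d f := by
  simp [skewDer, skewHom_ι]

lemma skewDer_one : skewDer σ ρ d 1 = 0 := by simp [skewDer]

lemma skewDer_mul (v w : TensorAlgebra k M) :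
    skewDer σ ρ d (v * w) = σ v * skewDer σ ρ d w + skewDer σ ρ d v * ρ w := by
  change skewHom σ ρ d (v * w) 0 1 = σ v * skewHom σ ρ d w 0 1 + skewHom σ ρ d v 0 1 * ρ w
  rw [map_mul, Matrix.mul_apply, Fin.sum_univ_two, (skewHom_eq σ ρ d v).1,
    (skewHom_eq σ ρ d w).2.1]

end SkewDer

/-! ### The normalized bar complex and the cohomology ring `E(A)` -/

/-- The dual `V` of `A₊`. -/
abbrev V : Type _ := Module.Dual k (Aplus k)

/-- The tensor algebra `T(V)`. As `A` is finite dimensional, its component `V ⊗ ⋯ ⊗ V`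
(`n` factors) is the space of linear forms on `A₊ ⊗ ⋯ ⊗ A₊`, that is, the degree `n` part of the
normalized bar complex, and the product of `T(V)` is the Yoneda product of cochains. -/
abbrev T : Type _ := TensorAlgebra k (V k)

/-- The multiplication `V ⊗ V → T(V)`. -/
def incl₂ : V k ⊗[k] V k →ₗ[k] T k :=
  LinearMap.mul' k (T k) ∘ₗ TensorProduct.map (TensorAlgebra.ι k) (TensorAlgebra.ι k)

lemma incl₂_tmul (f g : V k) :
    incl₂ k (f ⊗ₜ g) = TensorAlgebra.ι k f * TensorAlgebra.ι k g := by
  simp [incl₂]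

/-- The comultiplication of `V`, dual to the multiplication of `A₊`: it sends `f` to
`∑ fᵢ' ⊗ fᵢ''` with `f (x y) = ∑ fᵢ' x * fᵢ'' y`. -/
def comulV : V k →ₗ[k] V k ⊗[k] V k :=
  (TensorProduct.dualDistribEquiv k (Aplus k) (Aplus k)).symm.toLinearMap ∘ₗ
    (mulPlus k).dualMap

lemma dualDistrib_comulV (f : V k) :
    TensorProduct.dualDistrib k (Aplus k) (Aplus k) (comulV k f) = f ∘ₗ mulPlus k :=
  (TensorProduct.dualDistribEquiv k (Aplus k) (Aplus k)).apply_symm_apply (f ∘ₗ mulPlus k)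

lemma comulV_eq_iff (f : V k) (t : V k ⊗[k] V k) : comulV k f = t ↔
    ∀ x y, TensorProduct.dualDistrib k (Aplus k) (Aplus k) t (x ⊗ₜ y) = f (mulPlus k (x ⊗ₜ y)) := by
  have hinj : Function.Injective (TensorProduct.dualDistrib k (Aplus k) (Aplus k)) :=
    (TensorProduct.dualDistribEquiv k (Aplus k) (Aplus k)).injective
  rw [← hinj.eq_iff, dualDistrib_comulV]
  constructor
  · intro h x y
    rw [← h]; rfl
  · intro h
    exact TensorProduct.ext' fun x y => (h x y).symm

/-- The sign automorphism of `T(V)`, which is `(-1)ⁿ` in degree `n`. -/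
def sgn : T k →ₐ[k] T k := TensorAlgebra.lift k (-TensorAlgebra.ι k)

lemma sgn_ι (f : V k) : sgn k (TensorAlgebra.ι k f) = -TensorAlgebra.ι k f := by simp [sgn]

/-- The differential `δ` of the normalized bar complex: `δ f = -∑ fᵢ' ⊗ fᵢ''` for `f` in `V`, and
`δ (v w) = δ v * w + (-1)ⁿ v * δ w` for `v` of degree `n`. -/
def diff : T k →ₗ[k] T k := skewDer (sgn k) (AlgHom.id k (T k)) (-(incl₂ k ∘ₗ comulV k))

lemma diff_ι (f : V k) : diff k (TensorAlgebra.ι k f) = -incl₂ k (comulV k f) := by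
  simp [diff, skewDer_ι]

lemma diff_one : diff k 1 = 0 := skewDer_one _ _ _

lemma diff_mul (v w : T k) : diff k (v * w) = sgn k v * diff k w + diff k v * w :=
  skewDer_mul _ _ _ v w

lemma sgn_incl₂ (t : V k ⊗[k] V k) : sgn k (incl₂ k t) = incl₂ k t := by
  induction t with
  | zero => simp
  | tmul f g => simp [incl₂_tmul, sgn_ι]
  | add s t hs ht => simp [hs, ht]

lemma sgn_sgn (w : T k) : sgn k (sgn k w) = w := by
  induction w using tensor_induction with
  | h1 => simp
  | hι f w ih => simp [sgn_ι, ih]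
  | hadd v w hv hw => simp [hv, hw]
  | hsmul r v hv => simp [hv]

lemma diff_sgn (w : T k) : diff k (sgn k w) = -sgn k (diff k w) := by
  induction w using tensor_induction with
  | h1 => simp [diff_one]
  | hι f w ih =>
    rw [map_mul, diff_mul, diff_mul, ih, sgn_ι, map_neg, sgn_ι, map_neg, diff_ι, map_add, map_mul,
      map_mul, map_neg, map_neg, sgn_ι, sgn_incl₂]
    noncomm_ring
  | hadd v w hv hw => simp [hv, hw, add_comm]
  | hsmul r v hv => simp [hv]

/-- The algebra of cocycles. -/
def cocycles : Subalgebra k (T k) where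
  carrier := {w | diff k w = 0}
  mul_mem' {v w} hv hw := by
    simp only [Set.mem_ofPred_eq] at hv hw ⊢
    rw [diff_mul, hv, hw, mul_zero, zero_mul, add_zero]
  add_mem' {v w} hv hw := by
    simp only [Set.mem_ofPred_eq] at hv hw ⊢
    rw [map_add, hv, hw, add_zero]
  algebraMap_mem' r := by
    simp only [Set.mem_ofPred_eq]
    rw [Algebra.algebraMap_eq_smul_one, map_smul, diff_one, smul_zero]

lemma mem_cocycles (w : T k) : w ∈ cocycles k ↔ diff k w = 0 := Iff.rfl

/-- The ideal of coboundaries in the algebra of cocycles. -/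
def coboundaries : Ideal (cocycles k) where
  carrier := {w | ∃ u, diff k u = w}
  zero_mem' := ⟨0, by simp⟩
  add_mem' := by
    rintro _ _ ⟨u, hu⟩ ⟨v, hv⟩
    exact ⟨u + v, by simp [hu, hv]⟩
  smul_mem' := by
    rintro ⟨w, hw⟩ _ ⟨u, hu⟩
    refine ⟨sgn k w * u, ?_⟩
    rw [mem_cocycles] at hw
    rw [diff_mul, sgn_sgn, diff_sgn, hw, hu]
    simp

instance : (coboundaries k).IsTwoSided where
  mul_mem_of_left := by
    rintro _ ⟨w, hw⟩ ⟨u, hu⟩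
    refine ⟨u * w, ?_⟩
    rw [mem_cocycles] at hw
    rw [diff_mul, hw, hu]
    simp

/-- The cohomology ring `E(A) = Ext_A(k, k)` with the Yoneda product: the cohomology of the
normalized bar complex. -/
def E : Type _ := cocycles k ⧸ coboundaries k

instance : Ring (E k) := inferInstanceAs (Ring (cocycles k ⧸ coboundaries k))
instance : Algebra k (E k) := inferInstanceAs (Algebra k (cocycles k ⧸ coboundaries k))

/-- The cohomology class of a cocycle. -/
def cls : cocycles k →ₐ[k] E k := Ideal.Quotient.mkₐ k (coboundaries k)

/-! ### The action of `R` on `E(A)` -/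

/-- The automorphism of `T(V)` given by `f₁ ⊗ ⋯ ⊗ f_q ↦ f₁ β' ⊗ ⋯ ⊗ f_q β'`. -/
def betaT : T k →ₐ[k] T k := TensorAlgebra.lift k (TensorAlgebra.ι k ∘ₗ (twβPlus k).dualMap)

/-- The action of `c` on the normalized bar complex, given by
`c · (f₁ ⊗ ⋯ ⊗ f_q) = ∑ᵢ f₁ ⊗ ⋯ ⊗ fᵢ₋₁ ⊗ fᵢ α' ⊗ fᵢ₊₁ β' ⊗ ⋯ ⊗ f_q β'`. Equivalently,
`c · f = f ∘ (ε ⊗ id) ∘ τ (- ⊗ c)` for a linear form `f` on `A₊ ⊗ ⋯ ⊗ A₊`, where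
`τ : A₊ ⊗ ⋯ ⊗ A₊ ⊗ R → R ⊗ A₊ ⊗ ⋯ ⊗ A₊` moves `c` to the left through all the factors by
`x c = α' x + c (β' x)`, and `ε : R → k` is the augmentation. -/
def actT : T k →ₗ[k] T k :=
  skewDer (AlgHom.id k (T k)) (betaT k) (TensorAlgebra.ι k ∘ₗ (twαPlus k).dualMap)

lemma betaT_ι (f : V k) :
    betaT k (TensorAlgebra.ι k f) = TensorAlgebra.ι k ((twβPlus k).dualMap f) := by
  simp [betaT]

lemma actT_ι (f : V k) :
    actT k (TensorAlgebra.ι k f) = TensorAlgebra.ι k ((twαPlus k).dualMap f) := by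
  rw [actT, skewDer_ι]; rfl

lemma actT_one : actT k 1 = 0 := skewDer_one _ _ _

lemma actT_mul (v w : T k) : actT k (v * w) = v * actT k w + actT k v * betaT k w :=
  skewDer_mul _ _ _ v w

lemma dualDistrib_map (p q : Aplus k →ₗ[k] Aplus k) (t : V k ⊗[k] V k) (x y : Aplus k) :
    TensorProduct.dualDistrib k (Aplus k) (Aplus k)
      (TensorProduct.map p.dualMap q.dualMap t) (x ⊗ₜ y) =
    TensorProduct.dualDistrib k (Aplus k) (Aplus k) t (p x ⊗ₜ q y) := by
  induction t with
  | zero => simp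
  | tmul f g => simp
  | add s t hs ht => simp only [map_add, LinearMap.add_apply, hs, ht]

lemma comulV_beta (f : V k) : comulV k ((twβPlus k).dualMap f) =
    TensorProduct.map (twβPlus k).dualMap (twβPlus k).dualMap (comulV k f) := by
  rw [comulV_eq_iff]
  intro x y
  rw [dualDistrib_map, dualDistrib_comulV]
  change f _ = f _
  congr 1
  exact Subtype.ext (tw_mul k x y).2.symm

lemma comulV_alpha (f : V k) : comulV k ((twαPlus k).dualMap f) =
    TensorProduct.map (LinearMap.id : Aplus k →ₗ[k] Aplus k).dualMap (twαPlus k).dualMap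
        (comulV k f) +
      TensorProduct.map (twαPlus k).dualMap (twβPlus k).dualMap (comulV k f) := by
  rw [comulV_eq_iff]
  intro x y
  rw [map_add, LinearMap.add_apply, dualDistrib_map, dualDistrib_map, dualDistrib_comulV]
  change f _ + f _ = f _
  rw [← map_add]
  congr 1
  exact Subtype.ext (tw_mul k x y).1.symm

lemma betaT_incl₂ (t : V k ⊗[k] V k) : betaT k (incl₂ k t) =
    incl₂ k (TensorProduct.map (twβPlus k).dualMap (twβPlus k).dualMap t) := by
  induction t with
  | zero => simp
  | tmul f g => rw [TensorProduct.map_tmul, incl₂_tmul, incl₂_tmul, map_mul, betaT_ι, betaT_ι]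
  | add s t hs ht => simp only [map_add, hs, ht]

lemma actT_incl₂ (t : V k ⊗[k] V k) : actT k (incl₂ k t) =
    incl₂ k (TensorProduct.map (LinearMap.id : Aplus k →ₗ[k] Aplus k).dualMap
        (twαPlus k).dualMap t) +
      incl₂ k (TensorProduct.map (twαPlus k).dualMap (twβPlus k).dualMap t) := by
  induction t with
  | zero => simp
  | tmul f g =>
    rw [TensorProduct.map_tmul, TensorProduct.map_tmul, incl₂_tmul, incl₂_tmul, incl₂_tmul,
      actT_mul, betaT_ι, actT_ι, actT_ι]
    rfl
  | add s t hs ht =>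
    simp only [map_add, hs, ht]
    abel

lemma betaT_sgn (w : T k) : betaT k (sgn k w) = sgn k (betaT k w) := by
  induction w using tensor_induction with
  | h1 => simp
  | hι f w ih => rw [map_mul, map_mul, map_mul, map_mul, ih, sgn_ι, map_neg, betaT_ι, sgn_ι]
  | hadd v w hv hw => simp only [map_add, hv, hw]
  | hsmul r v hv => simp only [map_smul, hv]

lemma actT_sgn (w : T k) : actT k (sgn k w) = sgn k (actT k w) := by
  induction w using tensor_induction with
  | h1 => simp [actT_one]
  | hι f w ih =>
    rw [map_mul, actT_mul, actT_mul, map_add, map_mul, map_mul, ih, betaT_sgn, sgn_ι, map_neg,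
      actT_ι, sgn_ι]
  | hadd v w hv hw => simp only [map_add, hv, hw]
  | hsmul r v hv => simp only [map_smul, hv]

lemma diff_betaT (w : T k) : diff k (betaT k w) = betaT k (diff k w) := by
  induction w using tensor_induction with
  | h1 => simp [diff_one]
  | hι f w ih =>
    rw [map_mul, diff_mul, diff_mul, map_add, map_mul, map_mul, ih, betaT_ι, diff_ι, diff_ι,
      comulV_beta, map_neg, betaT_incl₂, sgn_ι, sgn_ι, map_neg, betaT_ι]
  | hadd v w hv hw => simp only [map_add, hv, hw]
  | hsmul r v hv => simp only [map_smul, hv]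

lemma diff_actT (w : T k) : diff k (actT k w) = actT k (diff k w) := by
  induction w using tensor_induction with
  | h1 => simp [diff_one, actT_one]
  | hι f w ih =>
    rw [diff_mul, actT_mul, map_add, map_add, diff_mul, diff_mul, actT_mul, actT_mul, ih,
      diff_betaT, ← actT_sgn, actT_ι, diff_ι, diff_ι, comulV_alpha, map_neg, actT_incl₂, map_add]
    noncomm_ring
  | hadd v w hv hw => simp only [map_add, hv, hw]
  | hsmul r v hv => simp only [map_smul, hv]

lemma dualMap_sq (f : V k) :
    (twαPlus k).dualMap ((twαPlus k).dualMap f) = 0 ∧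
    (twαPlus k).dualMap ((twβPlus k).dualMap f) +
      (twβPlus k).dualMap ((twαPlus k).dualMap f) = 0 := by
  constructor
  · ext x
    change f (twαPlus k (twαPlus k x)) = 0
    have : twαPlus k (twαPlus k x) = 0 := Subtype.ext (tw_sq k x).1
    rw [this, map_zero]
  · ext x
    change f (twβPlus k (twαPlus k x)) + f (twαPlus k (twβPlus k x)) = 0
    rw [← map_add]
    have : twβPlus k (twαPlus k x) + twαPlus k (twβPlus k x) = 0 := Subtype.ext (tw_sq k x).2
    rw [this, map_zero]

lemma actT_betaT (w : T k) : actT k (betaT k w) = -betaT k (actT k w) := by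
  induction w using tensor_induction with
  | h1 => simp [actT_one]
  | hι f w ih =>
    have h : TensorAlgebra.ι k ((twαPlus k).dualMap ((twβPlus k).dualMap f)) =
        -TensorAlgebra.ι k ((twβPlus k).dualMap ((twαPlus k).dualMap f)) := by
      rw [← map_neg, ← eq_neg_of_add_eq_zero_left (dualMap_sq k f).2]
    rw [map_mul, actT_mul, actT_mul, map_add, map_mul, map_mul, ih, betaT_ι, actT_ι, actT_ι,
      betaT_ι, h]
    noncomm_ring
  | hadd v w hv hw => rw [map_add, map_add, map_add, map_add, hv, hw, neg_add]
  | hsmul r v hv => simp only [map_smul, hv, smul_neg]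

lemma actT_actT (w : T k) : actT k (actT k w) = 0 := by
  induction w using tensor_induction with
  | h1 => simp [actT_one]
  | hι f w ih =>
    rw [actT_mul, map_add, actT_mul, actT_mul, ih, actT_betaT, actT_ι, actT_ι,
      (dualMap_sq k f).1, map_zero]
    noncomm_ring
  | hadd v w hv hw => simp only [map_add, hv, hw, add_zero]
  | hsmul r v hv => simp only [map_smul, hv, smul_zero]

/-- The restriction of `betaT` to the cocycles. -/
def betaZ : cocycles k →ₐ[k] cocycles k :=
  ((betaT k).comp (cocycles k).val).codRestrict (cocycles k) fun w => by
    rw [mem_cocycles]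
    change diff k (betaT k w) = 0
    rw [diff_betaT, (mem_cocycles k _).1 w.2, map_zero]

/-- The restriction of `actT` to the cocycles. -/
def actZ : cocycles k →ₗ[k] cocycles k where
  toFun w := ⟨actT k w, by rw [mem_cocycles, diff_actT, (mem_cocycles k _).1 w.2, map_zero]⟩
  map_add' v w := Subtype.ext (map_add (actT k) (v : T k) w)
  map_smul' r w := Subtype.ext (map_smul (actT k) r (w : T k))

lemma cls_eq_zero_iff (w : cocycles k) : cls k w = 0 ↔ ∃ u, diff k u = w :=
  Ideal.Quotient.eq_zero_iff_mem

lemma cls_surjective : Function.Surjective (cls k) := Ideal.Quotient.mk_surjective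

/-- The automorphism of `E(A)` induced by `β'`. -/
def beta : E k →ₐ[k] E k :=
  Ideal.Quotient.liftₐ (coboundaries k) ((cls k).comp (betaZ k)) (by
    rintro w ⟨u, hu⟩
    refine (cls_eq_zero_iff k _).2 ⟨betaT k u, ?_⟩
    rw [diff_betaT, hu]
    rfl)

lemma beta_cls (w : cocycles k) : beta k (cls k w) = cls k (betaZ k w) := rfl

/-- The action of `c` on `E(A)`. -/
def actE : E k →ₗ[k] E k :=
  ((coboundaries k).restrictScalars k).liftQ ((cls k).toLinearMap ∘ₗ actZ k) (by
    rintro w ⟨u, hu⟩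
    refine (cls_eq_zero_iff k _).2 ⟨actT k u, ?_⟩
    rw [diff_actT, hu]
    rfl) ∘ₗ (Submodule.Quotient.restrictScalarsEquiv k (coboundaries k)).symm.toLinearMap

lemma actE_cls (w : cocycles k) : actE k (cls k w) = cls k (actZ k w) := rfl

lemma actE_actE (w : E k) : actE k (actE k w) = 0 := by
  obtain ⟨w, rfl⟩ := cls_surjective k w
  rw [actE_cls, actE_cls]
  have : actZ k (actZ k w) = 0 := Subtype.ext (actT_actT k w)
  rw [this, map_zero]

/-- The algebra map `R → End(E(A))` sending `c` to its action. -/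
def actHom : R k →ₐ[k] Module.End k (E k) :=
  DualNumber.lift ⟨(Algebra.ofId k _, actE k),
    LinearMap.ext fun w => actE_actE k w, fun r => (Algebra.commutes r (actE k)).symm⟩

/-- The `R`-module structure of `E(A)`. -/
instance : Module (R k) (E k) := Module.compHom (E k) (actHom k).toRingHom

lemma c_smul (w : E k) : c k • w = actE k w := by
  change actHom k (DualNumber.eps) w = _
  rw [actHom, DualNumber.lift_apply_eps]

lemma algebraMap_smul_E (r : k) (w : E k) : algebraMap k (R k) r • w = r • w := by
  change actHom k (algebraMap k (R k) r) w = _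
  rw [AlgHom.commutes]
  rfl

/-! ### The generators `x`, `y`, `z` of `E(A)` -/

/-- The restriction to `A₊` of the dual basis of `1, a, b, ab, ba, aba`. -/
def p (i : Fin 6) : V k := (basisA k).coord i ∘ₗ (Aplus k).subtype

lemma p_apply (i : Fin 6) (x : Aplus k) : p k i x = coordB k 0 ((x : A k) : B k) i :=
  coordB_basisA k x i

lemma p_zero : p k 0 = 0 := by
  have h : (basisA k).coord 0 = (aug k).toLinearMap := by
    refine (basisA k).ext fun i => ?_
    rw [basisA_apply, Module.Basis.coord_apply, coordB_basisA, coordB_mon]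
    fin_cases i <;> simp [mon, aug_genA, aug_genB]
  ext x
  rw [p, h]
  exact x.2

lemma coord_mul (x y : A k) :
    coordB k 0 ((x * y : A k) : B k) = 
      ∑ i, coordB k 0 (x : B k) i • coordB k 0 ((mon k i * y : A k) : B k) := by
  have h : x = ∑ i, coordB k 0 (x : B k) i • mon k i := by
    conv_lhs => rw [← (basisA k).sum_repr x]
    simp only [coordB_basisA, basisA_apply]
  conv_lhs => rw [h, Finset.sum_mul]
  simp only [AddSubmonoidClass.coe_finsetSum, map_sum, smul_mul_assoc]
  simp

lemma coord_gen_mul (y : A k) :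
    coordB k 0 ((genA k * y : A k) : B k) = (matA k).mulVec (coordB k 0 (y : B k)) ∧
    coordB k 0 ((genB k * y : A k) : B k) = (matB k).mulVec (coordB k 0 (y : B k)) := by
  constructor <;> ext j <;>
  simp [coordB, genA, genB, regRep_a, regRep_b, Matrix.mul_apply, Fin.sum_univ_two, regRep_A,
    Matrix.mulVec, dotProduct]

lemma coord_mon_mul (y : A k) (i j : Fin 6) :
    coordB k 0 ((mon k i * y : A k) : B k) j =
      ((![1, matA k, matB k, matA k * matB k, matB k * matA k, matA k * matB k * matA k] i).mulVec
        (coordB k 0 (y : B k))) j := by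
  have hA := fun y => (coord_gen_mul k y).1
  have hB := fun y => (coord_gen_mul k y).2
  revert j
  rw [← funext_iff]
  fin_cases i <;> simp only [mon, mul_assoc]
  all_goals simp [hA, hB, mul_assoc, -MulMemClass.coe_mul, ← Matrix.mulVec_mulVec]

lemma p_mul (x y : Aplus k) :
    p k 1 (mulPlus k (x ⊗ₜ y)) = 0 ∧ p k 2 (mulPlus k (x ⊗ₜ y)) = 0 ∧
    p k 3 (mulPlus k (x ⊗ₜ y)) = p k 1 x * p k 2 y ∧
    p k 4 (mulPlus k (x ⊗ₜ y)) = p k 2 x * p k 1 y := by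
  have hx : coordB k 0 ((x : A k) : B k) 0 = 0 := by
    rw [← p_apply, p_zero]; rfl
  have hy : coordB k 0 ((y : A k) : B k) 0 = 0 := by
    rw [← p_apply, p_zero]; rfl
  simp only [p_apply, mulPlus_tmul, coord_mul k (x : A k), Finset.sum_apply, Pi.smul_apply,
    coord_mon_mul]
  refine ⟨?_, ?_, ?_, ?_⟩ <;>
  simp [Fin.sum_univ_succ, Matrix.mulVec, dotProduct, matA, matB, hx, hy]

lemma diff_p_one : diff k (TensorAlgebra.ι k (p k 1)) = 0 := by
  have : comulV k (p k 1) = 0 := by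
    rw [comulV_eq_iff]
    intro x y
    simpa using (p_mul k x y).1.symm
  rw [diff_ι, this, map_zero, neg_zero]

lemma diff_p_two : diff k (TensorAlgebra.ι k (p k 2)) = 0 := by
  have : comulV k (p k 2) = 0 := by
    rw [comulV_eq_iff]
    intro x y
    simpa using (p_mul k x y).2.1.symm
  rw [diff_ι, this, map_zero, neg_zero]

lemma diff_p_three : diff k (TensorAlgebra.ι k (p k 3)) =
    -(TensorAlgebra.ι k (p k 1) * TensorAlgebra.ι k (p k 2)) := by
  have : comulV k (p k 3) = p k 1 ⊗ₜ p k 2 := by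
    rw [comulV_eq_iff]
    intro x y
    simpa using (p_mul k x y).2.2.1.symm
  rw [diff_ι, this, incl₂_tmul]

lemma diff_p_four : diff k (TensorAlgebra.ι k (p k 4)) =
    -(TensorAlgebra.ι k (p k 2) * TensorAlgebra.ι k (p k 1)) := by
  have : comulV k (p k 4) = p k 2 ⊗ₜ p k 1 := by
    rw [comulV_eq_iff]
    intro x y
    simpa using (p_mul k x y).2.2.2.symm
  rw [diff_ι, this, incl₂_tmul]

/-- The class `x` of the dual basis element `p_a`. -/
def x : E k := cls k ⟨TensorAlgebra.ι k (p k 1), diff_p_one k⟩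

/-- The class `y` of the dual basis element `p_b`. -/
def y : E k := cls k ⟨TensorAlgebra.ι k (p k 2), diff_p_two k⟩

/-- The class `z` of `p_b ⊗ p_ab + p_ba ⊗ p_b`. -/
def z : E k := cls k
  ⟨TensorAlgebra.ι k (p k 2) * TensorAlgebra.ι k (p k 3) +
      TensorAlgebra.ι k (p k 4) * TensorAlgebra.ι k (p k 2), by
    rw [mem_cocycles, map_add, diff_mul, diff_mul, diff_p_two, diff_p_three, diff_p_four, sgn_ι]
    noncomm_ring⟩

end FominKirillov

end

noncomputable section

namespace FominKirillov

open TensorProduct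

variable (k : Type*) [Field k]

/-! ### The dual basis of `A₊` and the coefficients of a cochain -/

/-! The twisted Leibniz rule holds on cochains, since the action on `T(V)` is by construction a
derivation twisted by `β'`; it passes to cohomology. The relations `ac = -ba - cb` and `bc = -ab -
ca` give `α'` and `β'` on monomials, and a direct computation with cochains yields the values at
`x`, `y`, `z`.

Uniqueness needs that `x`, `y`, `z` generate `E(A)` (`adjoin_eq_top`): two derivations with the same
twist agree on a subalgebra. For generation, write `A₊ = aA + bA` with `aA ∩ bA` spanned by `aba`.
Left multiplication by `a` gives `0 → aA → A → aA → 0`, so the resolution of `aA` is periodic and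
its cohomology consists of polynomials in `x`; likewise `bA` gives polynomials in `y`
(`exists_primitive`). The Mayer–Vietoris sequence of `aA` and `bA` then writes a class as a constant
plus `x f(x) + y g(y)` plus a class coming from `aA ∩ bA ≅ k`, and this last map is multiplication
by `z` up to sign. Induction on the degree finishes (`exists_generated_add_diff`). All of this is
carried out with explicit cochains, expanded along their first tensor factor.

For the powers, `β z = z`, `zx = -yz` and `zy = -xz`. Hence `z` anticommutes with `x² - y²`, so `c`
kills `z²` and therefore `z^(2n)`; the Leibniz rule gives the rest. -/

/-- The projections to `A₊` of the monomials `1, a, b, ab, ba, aba`. -/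
def monPlus (i : Fin 6) : Aplus k :=
  ⟨mon k i - algebraMap k (A k) (aug k (mon k i)), by simp [mem_Aplus]⟩

/-- Index `0` is padding that keeps the numbering of the monomials of `A`: `monPlus k 0` and `p k 0`
both vanish, so sums over `Fin 6` are in effect over a basis of `A₊`. -/
lemma monPlus_zero : monPlus k 0 = 0 := Subtype.ext (by simp [monPlus, mon])

lemma aug_mon (i : Fin 6) (hi : i ≠ 0) : aug k (mon k i) = 0 := by
  fin_cases i <;> simp_all [mon, aug_genA, aug_genB]

lemma monPlus_coe (i : Fin 6) (hi : i ≠ 0) : (monPlus k i : A k) = mon k i := by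
  simp [monPlus, aug_mon k i hi]

lemma p_monPlus (i j : Fin 6) (hj : j ≠ 0) : p k i (monPlus k j) = if i = j then 1 else 0 := by
  rw [p_apply, monPlus_coe k j hj, coordB_mon, Pi.single_apply]

lemma sum_p_smul_monPlus (x : Aplus k) : ∑ i, p k i x • monPlus k i = x := by
  apply Subtype.ext
  have h := (basisA k).sum_repr (x : A k)
  rw [Fin.sum_univ_succ] at h ⊢
  have h0 : (basisA k).repr (x : A k) 0 = 0 := by
    rw [coordB_basisA, ← p_apply, p_zero]; rfl
  rw [h0, zero_smul, zero_add] at h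
  rw [monPlus_zero, smul_zero, zero_add]
  simp only [AddSubmonoidClass.coe_finsetSum, Submodule.coe_smul,
    monPlus_coe k _ (Fin.succ_ne_zero _), p_apply]
  simpa only [coordB_basisA, basisA_apply] using h

lemma dual_expand (f : V k) : f = ∑ i, f (monPlus k i) • p k i := by
  ext x
  conv_lhs => rw [← sum_p_smul_monPlus k x]
  simp [mul_comm]

/-- The generators of `T(V)` given by the dual basis of `A₊`. -/
def gT (i : Fin 6) : T k := TensorAlgebra.ι k (p k i)

lemma gT_zero : gT k 0 = 0 := by rw [gT, p_zero, map_zero]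

/-- The augmentation of `T(V)`, as an endomorphism. -/
def augT : T k →ₐ[k] T k := (Algebra.ofId k (T k)).comp TensorAlgebra.algebraMapInv

lemma augT_ι (f : V k) : augT k (TensorAlgebra.ι k f) = 0 := by
  simp [augT, TensorAlgebra.algebraMapInv]

/-- The coefficient `wᵢ` of `w = ε(w) + ∑ pᵢ wᵢ` in `T(V)`. -/
def coeff (i : Fin 6) : T k →ₗ[k] T k :=
  skewDer (augT k) (AlgHom.id k (T k))
    ((Algebra.linearMap k (T k)) ∘ₗ (LinearMap.applyₗ (monPlus k i)))

lemma coeff_one (i : Fin 6) : coeff k i 1 = 0 := skewDer_one _ _ _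

/-- The twist by the augmentation kills the term in which the derivation passes the first letter, so
only that letter is stripped. -/
lemma coeff_ι_mul (i : Fin 6) (f : V k) (w : T k) :
    coeff k i (TensorAlgebra.ι k f * w) = f (monPlus k i) • w := by
  rw [coeff, skewDer_mul, augT_ι, zero_mul, zero_add, skewDer_ι, Algebra.smul_def]
  rfl

lemma coeff_gT_mul (i j : Fin 6) (hi : i ≠ 0) (w : T k) :
    coeff k i (gT k j * w) = if j = i then w else 0 := by
  rw [gT, coeff_ι_mul, p_monPlus k j i hi, ite_smul, one_smul, zero_smul]

lemma eq_augT_add_sum (w : T k) : w = augT k w + ∑ i, gT k i * coeff k i w := by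
  induction w using tensor_induction with
  | h1 => simp [coeff_one]
  | hι f w ih =>
    rw [map_mul, augT_ι, zero_mul, zero_add]
    simp only [coeff_ι_mul, mul_smul_comm, ← smul_mul_assoc]
    rw [← Finset.sum_mul]
    congr 1
    conv_lhs => rw [dual_expand k f]
    simp [gT]
  | hadd v w hv hw =>
    conv_lhs => rw [hv, hw]
    simp only [map_add, mul_add, Finset.sum_add_distrib]
    abel
  | hsmul r v hv =>
    conv_lhs => rw [hv]
    simp only [map_smul, smul_add, mul_smul_comm, Finset.smul_sum]

lemma eq_augT_add (w : T k) : w = augT k w + gT k 1 * coeff k 1 w + gT k 2 * coeff k 2 w +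
    gT k 3 * coeff k 3 w + gT k 4 * coeff k 4 w + gT k 5 * coeff k 5 w := by
  conv_lhs => rw [eq_augT_add_sum k w]
  rw [Fin.sum_univ_six, gT_zero]
  noncomm_ring

/-! ### The degree filtration of `T(V)`. -/

/-- The elements of `T(V)` of degree less than `m`. -/
def degLT : ℕ → Submodule k (T k)
  | 0 => ⊥
  | m + 1 => ⨅ i, (degLT m).comap (coeff k i)

lemma mem_degLT_succ (m : ℕ) (w : T k) : w ∈ degLT k (m + 1) ↔ ∀ i, coeff k i w ∈ degLT k m := by
  simp [degLT]

lemma degLT_le_succ (m : ℕ) : degLT k m ≤ degLT k (m + 1) := by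
  induction m with
  | zero => simp [degLT]
  | succ m ih =>
    intro w hw
    rw [mem_degLT_succ] at hw ⊢
    exact fun i => ih (hw i)

lemma degLT_mono : Monotone (degLT k) := monotone_nat_of_le_succ (degLT_le_succ k)

lemma ι_mul_mem_degLT (f : V k) {m : ℕ} {w : T k} (hw : w ∈ degLT k m) :
    TensorAlgebra.ι k f * w ∈ degLT k (m + 1) := by
  rw [mem_degLT_succ]
  intro i
  rw [coeff_ι_mul]
  exact Submodule.smul_mem _ _ hw

lemma exists_mem_degLT (w : T k) : ∃ m, w ∈ degLT k m := by
  induction w using tensor_induction with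
  | h1 => exact ⟨1, by simp [mem_degLT_succ, coeff_one]⟩
  | hι f w ih =>
    obtain ⟨m, hm⟩ := ih
    exact ⟨m + 1, ι_mul_mem_degLT k f hm⟩
  | hadd v w hv hw =>
    obtain ⟨m, hm⟩ := hv
    obtain ⟨n, hn⟩ := hw
    exact ⟨max m n, Submodule.add_mem _ (degLT_mono k (le_max_left m n) hm)
      (degLT_mono k (le_max_right m n) hn)⟩
  | hsmul r v hv =>
    obtain ⟨m, hm⟩ := hv
    exact ⟨m, Submodule.smul_mem _ _ hm⟩

/-! ### The differential in coordinates -/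

/-- The four terms are the factorizations `a·ba`, `ab·a`, `b·ab`, `ba·b` of `aba = bab`. -/
lemma p_five_mul (x y : Aplus k) : p k 5 (mulPlus k (x ⊗ₜ y)) =
    p k 1 x * p k 4 y + p k 3 x * p k 1 y + p k 2 x * p k 3 y + p k 4 x * p k 2 y := by
  have hx : coordB k 0 ((x : A k) : B k) 0 = 0 := by
    rw [← p_apply, p_zero]; rfl
  have hy : coordB k 0 ((y : A k) : B k) 0 = 0 := by
    rw [← p_apply, p_zero]; rfl
  simp only [p_apply, mulPlus_tmul, coord_mul k (x : A k), Finset.sum_apply, Pi.smul_apply,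
    coord_mon_mul]
  simp [Fin.sum_univ_succ, Matrix.mulVec, dotProduct, matA, matB, hx, hy]
  ring

lemma diff_gT_one : diff k (gT k 1) = 0 := diff_p_one k
lemma diff_gT_two : diff k (gT k 2) = 0 := diff_p_two k
lemma diff_gT_three : diff k (gT k 3) = -(gT k 1 * gT k 2) := diff_p_three k
lemma diff_gT_four : diff k (gT k 4) = -(gT k 2 * gT k 1) := diff_p_four k

lemma diff_gT_five : diff k (gT k 5) =
    -(gT k 1 * gT k 4 + gT k 3 * gT k 1 + gT k 2 * gT k 3 + gT k 4 * gT k 2) := by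
  have : comulV k (p k 5) = p k 1 ⊗ₜ p k 4 + p k 3 ⊗ₜ p k 1 + p k 2 ⊗ₜ p k 3 +
      p k 4 ⊗ₜ p k 2 := by
    rw [comulV_eq_iff]
    intro x y
    simpa using (p_five_mul k x y).symm
  rw [gT, diff_ι, this, map_add, map_add, map_add]
  simp only [incl₂_tmul, gT]

lemma diff_gT_mul (i : Fin 6) (w : T k) :
    diff k (gT k i * w) = diff k (gT k i) * w - gT k i * diff k w := by
  rw [diff_mul, gT, sgn_ι]
  noncomm_ring

lemma diff_augT (w : T k) : diff k (augT k w) = 0 := by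
  change diff k (algebraMap k (T k) _) = 0
  rw [Algebra.algebraMap_eq_smul_one, map_smul, diff_one, smul_zero]

/-- Moving `δ` past one letter gives the overall sign; the other terms come from the quadratic `δ
p_ab`, `δ p_ba`, `δ p_aba`, regrouped by first letter. -/
lemma diff_expand (w : T k) : diff k w =
    -(gT k 1 * (diff k (coeff k 1 w) + gT k 2 * coeff k 3 w + gT k 4 * coeff k 5 w) +
      gT k 2 * (diff k (coeff k 2 w) + gT k 1 * coeff k 4 w + gT k 3 * coeff k 5 w) +
      gT k 3 * (diff k (coeff k 3 w) + gT k 1 * coeff k 5 w) +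
      gT k 4 * (diff k (coeff k 4 w) + gT k 2 * coeff k 5 w) +
      gT k 5 * diff k (coeff k 5 w)) := by
  conv_lhs => rw [eq_augT_add k w]
  simp only [map_add, diff_augT, diff_gT_mul, diff_gT_one, diff_gT_two, diff_gT_three,
    diff_gT_four, diff_gT_five]
  noncomm_ring

/-- For a cocycle `w` these equations split into one system for the coefficients at `a, ab, aba` (a
basis of `aA`) and one for those at `b, ba, aba` (a basis of `bA`), sharing only the coefficient at
`aba`. -/
lemma coeff_diff (w : T k) :
    coeff k 1 (diff k w) =
      -(diff k (coeff k 1 w) + gT k 2 * coeff k 3 w + gT k 4 * coeff k 5 w) ∧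
    coeff k 2 (diff k w) =
      -(diff k (coeff k 2 w) + gT k 1 * coeff k 4 w + gT k 3 * coeff k 5 w) ∧
    coeff k 3 (diff k w) = -(diff k (coeff k 3 w) + gT k 1 * coeff k 5 w) ∧
    coeff k 4 (diff k w) = -(diff k (coeff k 4 w) + gT k 2 * coeff k 5 w) ∧
    coeff k 5 (diff k w) = -diff k (coeff k 5 w) := by
  rw [diff_expand k w]
  simp only [map_neg, map_add (coeff k _) _ _]
  refine ⟨?_, ?_, ?_, ?_, ?_⟩ <;>
  · simp only [coeff_gT_mul k _ _ (by decide : (1 : Fin 6) ≠ 0),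
      coeff_gT_mul k _ _ (by decide : (2 : Fin 6) ≠ 0),
      coeff_gT_mul k _ _ (by decide : (3 : Fin 6) ≠ 0),
      coeff_gT_mul k _ _ (by decide : (4 : Fin 6) ≠ 0),
      coeff_gT_mul k _ _ (by decide : (5 : Fin 6) ≠ 0)]
    simp

/-! ### Generation of the cohomology ring -/

/-- The cocycle `p_b ⊗ p_ab + p_ba ⊗ p_b`. -/
def zT : T k := gT k 2 * gT k 3 + gT k 4 * gT k 2

lemma diff_zT : diff k (zT k) = 0 := by
  rw [zT, map_add, diff_gT_mul, diff_gT_mul, diff_gT_two, diff_gT_three, diff_gT_four]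
  noncomm_ring

lemma diff_zT_mul (w : T k) : diff k (zT k * w) = zT k * diff k w := by
  have h : sgn k (zT k) = zT k := by simp [zT, gT, sgn_ι]
  rw [diff_mul, h, diff_zT, zero_mul, add_zero]

/-! ### The cohomology of the right ideals `aA` and `bA`. -/

variable {k} in
/-- The complex of triples computing `Ext_A(aA, k)`, for `(i, j, l, m) = (1, 2, 3, 4)`, or
`Ext_A(bA, k)`, for `(i, j, l, m) = (2, 1, 4, 3)`: its cocycles are cohomologous to `(f, 0, 0)`,
where `f` is a polynomial in `pᵢ`. -/
lemma exists_primitive {i j l m : Fin 6}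
    (h : (i = 1 ∧ j = 2 ∧ l = 3 ∧ m = 4) ∨ (i = 2 ∧ j = 1 ∧ l = 4 ∧ m = 3)) (n : ℕ) :
    ∀ u₁ u₂ u₃ : T k, u₁ ∈ degLT k n →
      diff k u₁ + gT k j * u₂ + gT k m * u₃ = 0 → diff k u₂ + gT k i * u₃ = 0 → diff k u₃ = 0 →
      ∃ f ∈ Algebra.adjoin k {gT k i}, ∃ s₁ s₂ s₃ : T k, s₃ ∈ degLT k n ∧
        u₁ = f - diff k s₁ - gT k j * s₂ - gT k m * s₃ ∧ u₂ = -diff k s₂ - gT k i * s₃ ∧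
        u₃ = -diff k s₃ := by
  -- The data `hexp`, `hcd`, `hd`, `hne` are symmetric under exchanging `a` and `b`; once they are
  -- established the two cases need no further distinction.
  have hexp (w : T k) : w = augT k w + gT k i * coeff k i w + gT k j * coeff k j w +
      gT k l * coeff k l w + gT k m * coeff k m w + gT k 5 * coeff k 5 w := by
    rcases h with ⟨rfl, rfl, rfl, rfl⟩ | ⟨rfl, rfl, rfl, rfl⟩
    · exact eq_augT_add k w
    · conv_lhs => rw [eq_augT_add k w]
      abel
  have hcd (w : T k) :
      coeff k i (diff k w) =
        -(diff k (coeff k i w) + gT k j * coeff k l w + gT k m * coeff k 5 w) ∧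
      coeff k j (diff k w) =
        -(diff k (coeff k j w) + gT k i * coeff k m w + gT k l * coeff k 5 w) ∧
      coeff k l (diff k w) = -(diff k (coeff k l w) + gT k i * coeff k 5 w) ∧
      coeff k m (diff k w) = -(diff k (coeff k m w) + gT k j * coeff k 5 w) ∧
      coeff k 5 (diff k w) = -diff k (coeff k 5 w) := by
    obtain ⟨h1, h2, h3, h4, h5⟩ := coeff_diff k w
    rcases h with ⟨rfl, rfl, rfl, rfl⟩ | ⟨rfl, rfl, rfl, rfl⟩
    · exact ⟨h1, h2, h3, h4, h5⟩
    · exact ⟨h2, h1, h4, h3, h5⟩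
  have hd : diff k (gT k i) = 0 ∧ diff k (gT k j) = 0 ∧
      diff k (gT k l) = -(gT k i * gT k j) ∧ diff k (gT k m) = -(gT k j * gT k i) ∧
      diff k (gT k 5) =
        -(gT k i * gT k m + gT k l * gT k i + gT k j * gT k l + gT k m * gT k j) := by
    rcases h with ⟨rfl, rfl, rfl, rfl⟩ | ⟨rfl, rfl, rfl, rfl⟩
    · exact ⟨diff_gT_one k, diff_gT_two k, diff_gT_three k, diff_gT_four k, diff_gT_five k⟩
    · refine ⟨diff_gT_two k, diff_gT_one k, diff_gT_four k, diff_gT_three k, ?_⟩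
      rw [diff_gT_five]
      abel
  have hne : i ≠ 0 ∧ j ≠ 0 ∧ l ≠ 0 ∧ m ≠ 0 ∧ j ≠ i ∧ j ≠ l ∧ j ≠ m ∧ j ≠ 5 ∧ m ≠ i ∧ m ≠ l ∧
      m ≠ 5 := by
    rcases h with ⟨rfl, rfl, rfl, rfl⟩ | ⟨rfl, rfl, rfl, rfl⟩ <;> decide
  clear h
  obtain ⟨hi, hj, hl, hm, hji, hjl, hjm, hj5, hmi, hml, hm5⟩ := hne
  obtain ⟨hdi, hdj, hdl, hdm, hd5⟩ := hd
  -- Periodicity in coordinates: the right annihilator of `a` is `aA`, so the coefficients of `u₁`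
  -- at `i, l, 5` form a cocycle triple of the same kind one degree lower, while those at `j` and
  -- `m` express `u₂` and `u₃`.
  have hcoeff : ∀ u₁ u₂ u₃ : T k, diff k u₁ + gT k j * u₂ + gT k m * u₃ = 0 →
      diff k (coeff k i u₁) + gT k j * coeff k l u₁ + gT k m * coeff k 5 u₁ = 0 ∧
      diff k (coeff k l u₁) + gT k i * coeff k 5 u₁ = 0 ∧ diff k (coeff k 5 u₁) = 0 ∧
      u₂ = diff k (coeff k j u₁) + gT k i * coeff k m u₁ + gT k l * coeff k 5 u₁ ∧
      u₃ = diff k (coeff k m u₁) + gT k j * coeff k 5 u₁ := by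
    intro u₁ u₂ u₃ h
    obtain ⟨c1, c2, c3, c4, c5⟩ := hcd u₁
    have key (q : Fin 6) (hq : q ≠ 0) : coeff k q (diff k u₁) +
        (if j = q then u₂ else 0) + (if m = q then u₃ else 0) = 0 := by
      rw [← coeff_gT_mul k q j hq, ← coeff_gT_mul k q m hq, ← map_add, ← map_add, h, map_zero]
    have k1 := key i hi
    have k2 := key j hj
    have k3 := key l hl
    have k4 := key m hm
    have k5 := key 5 (by decide)
    simp only [c1, c2, c3, c4, c5, if_neg hji, if_neg hjl, if_neg hjm, if_neg hj5, if_neg hmi,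
      if_neg hml, if_neg hm5, if_neg hjm.symm, if_true, add_zero, neg_eq_zero] at k1 k2 k3 k4 k5
    exact ⟨k1, k3, k5, (neg_add_eq_zero.1 k2).symm, (neg_add_eq_zero.1 k4).symm⟩
  induction n with
  | zero =>
    intro u₁ u₂ u₃ hu h _ _
    obtain rfl : u₁ = 0 := by simpa [degLT] using hu
    obtain ⟨-, -, -, rfl, rfl⟩ := hcoeff _ _ _ h
    exact ⟨0, zero_mem _, 0, 0, 0, zero_mem _, by simp, by simp, by simp⟩
  | succ n ih =>
    intro u₁ u₂ u₃ hu h _ _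
    obtain ⟨h1, h2, h3, rfl, rfl⟩ := hcoeff _ _ _ h
    rw [mem_degLT_succ] at hu
    obtain ⟨f, hf, s₁, s₂, s₃, hs, e1, e2, e3⟩ := ih _ _ _ (hu i) h1 h2 h3
    -- `s₁` lifts the primitive of the smaller triple to `T(V)`. Its differential also produces
    -- terms starting with `p_j` and `p_m`; these are absorbed by the corrections `p_l s₃` and `p_j
    -- s₃` in the new second and third components.
    refine ⟨augT k u₁ + gT k i * f, ?_, -(gT k i * s₁ + gT k l * s₂ + gT k 5 * s₃),
      -coeff k j u₁ - gT k l * s₃, -coeff k m u₁ - gT k j * s₃, ?_, ?_, ?_, ?_⟩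
    · exact add_mem (Subalgebra.algebraMap_mem _ _)
        (mul_mem (Algebra.self_mem_adjoin_singleton k _) hf)
    · exact sub_mem (neg_mem (degLT_le_succ k n (hu m))) (ι_mul_mem_degLT k _ hs)
    · conv_lhs => rw [hexp u₁, e1, e2, e3]
      simp only [map_neg, map_add, diff_gT_mul, hdi, hdl, hd5]
      noncomm_ring
    · rw [e3]
      simp only [map_neg, map_sub, diff_gT_mul, hdl]
      noncomm_ring
    · rw [e3]
      simp only [map_neg, map_sub, diff_gT_mul, hdj]
      noncomm_ring

/-- The subalgebra of `T(V)` generated by the cocycles which represent `x`, `y` and `z`. -/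
def genT : Subalgebra k (T k) := Algebra.adjoin k {gT k 1, gT k 2, zT k}

/-- Mayer–Vietoris for `A₊ = aA + bA`: primitives on `aA` and on `bA` need only agree on `aA ∩ bA`
up to a cocycle of smaller degree, which re-enters multiplied by `z`. -/
lemma exists_generated_add_diff (n : ℕ) : ∀ w ∈ degLT k n, diff k w = 0 →
    ∃ g ∈ genT k, ∃ u, w = g + diff k u := by
  have h1 : gT k 1 ∈ genT k := Algebra.subset_adjoin (by simp)
  have h2 : gT k 2 ∈ genT k := Algebra.subset_adjoin (by simp)
  have h3 : zT k ∈ genT k := Algebra.subset_adjoin (by simp)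
  induction n with
  | zero =>
    intro w hw _
    obtain rfl : w = 0 := by simpa [degLT] using hw
    exact ⟨0, zero_mem _, 0, by simp⟩
  | succ n ih =>
    intro w hw hd
    rw [mem_degLT_succ] at hw
    obtain ⟨c1, c2, c3, c4, c5⟩ := coeff_diff k w
    simp only [hd, map_zero, zero_eq_neg] at c1 c2 c3 c4 c5
    obtain ⟨f, hf, s₁, s₂, s₃, hs, e1, e2, e3⟩ :=
      exists_primitive (Or.inl ⟨rfl, rfl, rfl, rfl⟩) n _ _ _ (hw 1) c1 c3 c5
    obtain ⟨g, hg, r₁, r₂, r₃, hr, e4, e5, e6⟩ :=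
      exists_primitive (Or.inr ⟨rfl, rfl, rfl, rfl⟩) n _ _ _ (hw 2) c2 c4 c5
    -- Both primitives restrict to the common coefficient at `aba`, so `r₃ - s₃` is a cocycle; the
    -- bounds on `s₃` and `r₃` make the induction hypothesis applicable.
    have hsr : diff k r₃ = diff k s₃ := neg_injective (e6.symm.trans e3)
    obtain ⟨v, hv, u, hu⟩ := ih (r₃ - s₃) (sub_mem hr hs) (by rw [map_sub, hsr, sub_self])
    have hr₃ : r₃ = s₃ + (v + diff k u) := by rw [← hu]; abel
    -- The `r₃` terms add up to `-z r₃`, and the `s₃` terms to `δ(p_aba s₃) + z s₃`; this leaves `-z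
    -- (r₃ - s₃) = -z v - δ(z u)`.
    refine ⟨augT k w + gT k 1 * f + gT k 2 * g - zT k * v, ?_,
      gT k 1 * s₁ + gT k 3 * s₂ + gT k 2 * r₁ + gT k 4 * r₂ + gT k 5 * s₃ - zT k * u, ?_⟩
    · refine sub_mem (add_mem (add_mem (Subalgebra.algebraMap_mem _ _) (mul_mem h1 ?_))
        (mul_mem h2 ?_)) (mul_mem h3 hv)
      · exact Algebra.adjoin_mono (by simp) hf
      · exact Algebra.adjoin_mono (by simp) hg
    · conv_lhs => rw [eq_augT_add k w, e1, e2, e3, e4, e5, hr₃]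
      simp only [map_add, map_sub, diff_gT_mul, diff_zT_mul, diff_gT_one, diff_gT_two,
        diff_gT_three, diff_gT_four, diff_gT_five]
      rw [zT]
      noncomm_ring

lemma cls_eq_iff (v w : cocycles k) : cls k v = cls k w ↔ ∃ u, diff k u = (v : T k) - w := by
  rw [← sub_eq_zero, ← map_sub, cls_eq_zero_iff]
  rfl

/-- The algebra `E(A)` is generated by `x`, `y` and `z`. -/
theorem adjoin_eq_top : Algebra.adjoin k {x k, y k, z k} = ⊤ := by
  refine eq_top_iff.2 fun w _ => ?_
  obtain ⟨⟨w, hw⟩, rfl⟩ := cls_surjective k w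
  obtain ⟨n, hn⟩ := exists_mem_degLT k w
  obtain ⟨g, hg, u, hu⟩ := exists_generated_add_diff k n w hn hw
  -- The class of `g` requires a proof that `g` is a cocycle, so both facts are proved in one
  -- induction.
  have key : ∃ hz : diff k g = 0, cls k ⟨g, hz⟩ ∈ Algebra.adjoin k {x k, y k, z k} := by
    clear hu
    induction hg using Algebra.adjoin_induction with
    | mem v hv =>
      rcases hv with rfl | rfl | rfl
      · exact ⟨diff_gT_one k, Algebra.subset_adjoin (Or.inl rfl)⟩
      · exact ⟨diff_gT_two k, Algebra.subset_adjoin (Or.inr (Or.inl rfl))⟩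
      · exact ⟨diff_zT k, Algebra.subset_adjoin (Or.inr (Or.inr rfl))⟩
    | algebraMap r =>
      refine ⟨(cocycles k).algebraMap_mem r, ?_⟩
      have : cls k ⟨algebraMap k (T k) r, (cocycles k).algebraMap_mem r⟩ = algebraMap k (E k) r :=
        (cls k).commutes r
      rw [this]
      exact Subalgebra.algebraMap_mem _ r
    | add u v _ _ hu hv =>
      obtain ⟨hu, hu'⟩ := hu
      obtain ⟨hv, hv'⟩ := hv
      exact ⟨(cocycles k).add_mem hu hv, add_mem hu' hv'⟩
    | mul u v _ _ hu hv =>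
      obtain ⟨hu, hu'⟩ := hu
      obtain ⟨hv, hv'⟩ := hv
      exact ⟨(cocycles k).mul_mem hu hv, mul_mem hu' hv'⟩
  obtain ⟨hz, hmem⟩ := key
  have : cls k ⟨w, hw⟩ = cls k ⟨g, hz⟩ := by
    rw [cls_eq_iff]
    exact ⟨u, eq_sub_of_add_eq' hu.symm⟩
  rwa [this]

/-! ### The action of `c` on the generators -/

lemma tw_genA : twα k (genA k) = -(genB k * genA k) ∧ twβ k (genA k) = -genB k := by
  refine mulRA_unique k ?_
  rw [← mul_c_eq]
  simp only [genA, genB]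
  push_cast
  rw [gen_a_c]
  noncomm_ring

lemma tw_genB : twα k (genB k) = -(genA k * genB k) ∧ twβ k (genB k) = -genA k := by
  refine mulRA_unique k ?_
  rw [← mul_c_eq]
  simp only [genA, genB]
  push_cast
  rw [gen_b_c]
  noncomm_ring

lemma twβ_mon : twβ k (mon k 1) = -mon k 2 ∧ twβ k (mon k 2) = -mon k 1 ∧
    twβ k (mon k 3) = mon k 4 ∧ twβ k (mon k 4) = mon k 3 ∧ twβ k (mon k 5) = -mon k 5 := by
  simp [mon, tw_mul, tw_genA, tw_genB, braid]

/-- On `ab`, `ba` and `aba` the twisted Leibniz rule leaves only terms containing `a²` or `b²`. -/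
lemma twα_mon : twα k (mon k 1) = -mon k 4 ∧ twα k (mon k 2) = -mon k 3 ∧
    twα k (mon k 3) = 0 ∧ twα k (mon k 4) = 0 ∧ twα k (mon k 5) = 0 := by
  have h : genA k * (genB k * genA k) = genB k * (genA k * genB k) := by
    rw [← mul_assoc, braid, mul_assoc]
  have hA (v : A k) : genA k * (genA k * v) = 0 := by rw [← mul_assoc, genA_sq, zero_mul]
  have hB (v : A k) : genB k * (genB k * v) = 0 := by rw [← mul_assoc, genB_sq, zero_mul]
  simp [mon, tw_mul, tw_genA, tw_genB, mul_assoc, genA_sq, genB_sq, hA, hB, h]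

lemma twβPlus_monPlus : twβPlus k (monPlus k 1) = -monPlus k 2 ∧
    twβPlus k (monPlus k 2) = -monPlus k 1 ∧ twβPlus k (monPlus k 3) = monPlus k 4 ∧
    twβPlus k (monPlus k 4) = monPlus k 3 ∧ twβPlus k (monPlus k 5) = -monPlus k 5 := by
  obtain ⟨h1, h2, h3, h4, h5⟩ := twβ_mon k
  have hc (i : Fin 6) (hi : i ≠ 0) :
      ((twβPlus k (monPlus k i) : Aplus k) : A k) = twβ k (mon k i) := by
    rw [← monPlus_coe k i hi]
    rfl
  refine ⟨?_, ?_, ?_, ?_, ?_⟩ <;> apply Subtype.ext <;> simp [monPlus_coe, *]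

lemma twαPlus_monPlus : twαPlus k (monPlus k 1) = -monPlus k 4 ∧
    twαPlus k (monPlus k 2) = -monPlus k 3 ∧ twαPlus k (monPlus k 3) = 0 ∧
    twαPlus k (monPlus k 4) = 0 ∧ twαPlus k (monPlus k 5) = 0 := by
  obtain ⟨h1, h2, h3, h4, h5⟩ := twα_mon k
  have hc (i : Fin 6) (hi : i ≠ 0) :
      ((twαPlus k (monPlus k i) : Aplus k) : A k) = twα k (mon k i) := by
    rw [← monPlus_coe k i hi]
    rfl
  refine ⟨?_, ?_, ?_, ?_, ?_⟩ <;> apply Subtype.ext <;> simp [monPlus_coe, *]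

lemma betaT_gT : betaT k (gT k 1) = -gT k 2 ∧ betaT k (gT k 2) = -gT k 1 ∧
    betaT k (gT k 3) = gT k 4 ∧ betaT k (gT k 4) = gT k 3 := by
  obtain ⟨h1, h2, h3, h4, h5⟩ := twβPlus_monPlus k
  -- Precomposition with `β'` acts on the dual basis by the transposed matrix.
  have key (i : Fin 6) : betaT k (gT k i) =
      ∑ j, p k i (twβPlus k (monPlus k j)) • gT k j := by
    rw [gT, betaT_ι, dual_expand k ((twβPlus k).dualMap (p k i))]
    simp [gT]
  simp only [key, Fin.sum_univ_six, monPlus_zero, map_zero, h1, h2, h3, h4, h5, map_neg]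
  simp [p_monPlus]

lemma actT_gT : actT k (gT k 1) = 0 ∧ actT k (gT k 2) = 0 ∧
    actT k (gT k 3) = -gT k 2 ∧ actT k (gT k 4) = -gT k 1 := by
  obtain ⟨h1, h2, h3, h4, h5⟩ := twαPlus_monPlus k
  have key (i : Fin 6) : actT k (gT k i) =
      ∑ j, p k i (twαPlus k (monPlus k j)) • gT k j := by
    rw [gT, actT_ι, dual_expand k ((twαPlus k).dualMap (p k i))]
    simp [gT]
  simp only [key, Fin.sum_univ_six, monPlus_zero, map_zero, h1, h2, h3, h4, h5, map_neg]
  simp [p_monPlus]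

lemma c_smul_x : c k • x k = 0 := by
  rw [c_smul, x, actE_cls, cls_eq_zero_iff]
  exact ⟨0, (map_zero _).trans (actT_gT k).1.symm⟩

lemma c_smul_y : c k • y k = 0 := by
  rw [c_smul, y, actE_cls, cls_eq_zero_iff]
  exact ⟨0, (map_zero _).trans (actT_gT k).2.1.symm⟩

/-- Already true for cochains: `c·p_ab = -p_b` gives `-p_b²`, and `(c·p_ba)(p_b β') = (-p_a)(-p_a)`
gives `p_a²`. -/
lemma c_smul_z : c k • z k = x k ^ 2 - y k ^ 2 := by
  rw [c_smul, x, y, z, actE_cls, ← map_pow, ← map_pow, ← map_sub]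
  congr 1
  refine Subtype.ext ?_
  change actT k (gT k 2 * gT k 3 + gT k 4 * gT k 2) = gT k 1 ^ 2 - gT k 2 ^ 2
  obtain ⟨h1, h2, h3, h4⟩ := actT_gT k
  rw [map_add, actT_mul, actT_mul, h2, h3, h4, (betaT_gT k).2.1]
  noncomm_ring

/-! ### Relations between `x`, `y`, `z` and `β`. -/

lemma beta_z : beta k (z k) = z k := by
  rw [z, beta_cls, cls_eq_iff]
  -- `β` turns the half `b·ab`, `ba·b` of `δ p_aba` into minus the half `a·ba`, `ab·a`, so the
  -- difference is exactly `δ p_aba`.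
  refine ⟨gT k 5, ?_⟩
  change _ = betaT k (gT k 2 * gT k 3 + gT k 4 * gT k 2) - (gT k 2 * gT k 3 + gT k 4 * gT k 2)
  obtain ⟨h1, h2, h3, h4⟩ := betaT_gT k
  rw [map_add, map_mul, map_mul, h2, h3, h4, diff_gT_five]
  noncomm_ring

lemma z_mul_x : z k * x k = -(y k * z k) := by
  rw [x, y, z, ← map_mul (cls k), ← map_mul (cls k), ← map_neg (cls k), cls_eq_iff]
  -- `δ(p_b p_aba)` contains `p_b z`; adding `δ(p_ba p_ba)` trades the unwanted `p_b p_a p_ba` for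
  -- the missing term `p_ba p_b p_a` of `z p_a`.
  refine ⟨gT k 2 * gT k 5 + gT k 4 * gT k 4, ?_⟩
  change _ = (gT k 2 * gT k 3 + gT k 4 * gT k 2) * gT k 1 -
    -(gT k 2 * (gT k 2 * gT k 3 + gT k 4 * gT k 2))
  simp only [map_add, diff_gT_mul, diff_gT_two, diff_gT_four, diff_gT_five]
  noncomm_ring

lemma z_mul_y : z k * y k = -(x k * z k) := by
  rw [x, y, z, ← map_mul (cls k), ← map_mul (cls k), ← map_neg (cls k), cls_eq_iff]
  refine ⟨-(gT k 5 * gT k 2 + gT k 3 * gT k 3), ?_⟩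
  change _ = (gT k 2 * gT k 3 + gT k 4 * gT k 2) * gT k 2 -
    -(gT k 1 * (gT k 2 * gT k 3 + gT k 4 * gT k 2))
  simp only [map_neg, map_add, diff_gT_mul, diff_gT_two, diff_gT_three, diff_gT_five]
  noncomm_ring

/-- The rule `actT_mul` for cochains, read on representatives. -/
lemma c_smul_mul (v w : E k) : c k • (v * w) = v * (c k • w) + (c k • v) * beta k w := by
  obtain ⟨v, rfl⟩ := cls_surjective k v
  obtain ⟨w, rfl⟩ := cls_surjective k w
  rw [c_smul, c_smul, c_smul, ← map_mul, actE_cls, actE_cls, actE_cls, beta_cls, ← map_mul,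
    ← map_mul, ← map_add]
  congr 1
  exact Subtype.ext (actT_mul k v w)

variable {k} in
/-- A `β`-derivation of `E(A)` is determined by its values at `x`, `y` and `z`. -/
lemma eq_of_skew_derivation {D D' : E k →ₗ[k] E k}
    (hD : ∀ v w : E k, D (v * w) = v * D w + D v * beta k w)
    (hD' : ∀ v w : E k, D' (v * w) = v * D' w + D' v * beta k w)
    (hx : D (x k) = D' (x k)) (hy : D (y k) = D' (y k)) (hz : D (z k) = D' (z k)) : D = D' := by
  have h_one {F : E k →ₗ[k] E k} (hF : ∀ v w : E k, F (v * w) = v * F w + F v * beta k w) :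
      F 1 = 0 := by simpa using hF 1 1
  refine LinearMap.ext fun w => ?_
  have hw : w ∈ Algebra.adjoin k {x k, y k, z k} := by rw [adjoin_eq_top]; trivial
  induction hw using Algebra.adjoin_induction with
  | mem v hv => rcases hv with rfl | rfl | rfl <;> assumption
  | algebraMap r => simp [Algebra.algebraMap_eq_smul_one, h_one hD, h_one hD']
  | add u v _ _ hu hv => rw [map_add, map_add, hu, hv]
  | mul u v _ _ hu hv => rw [hD, hD', hu, hv]

/-- Moving `z` past two factors exchanges `x²` and `y²`, the signs cancelling. -/
lemma z_mul_sq_sub_sq : z k * (x k ^ 2 - y k ^ 2) = -((x k ^ 2 - y k ^ 2) * z k) := by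
  have hx : z k * x k ^ 2 = y k ^ 2 * z k := by
    rw [pow_two, ← mul_assoc, z_mul_x, neg_mul, mul_assoc, z_mul_x]
    noncomm_ring
  have hy : z k * y k ^ 2 = x k ^ 2 * z k := by
    rw [pow_two, ← mul_assoc, z_mul_y, neg_mul, mul_assoc, z_mul_y]
    noncomm_ring
  rw [mul_sub, hx, hy]
  noncomm_ring

lemma c_smul_one : c k • (1 : E k) = 0 := by simpa using c_smul_mul k 1 1

lemma c_smul_pow_of_eq_zero {t : E k} (ht : c k • t = 0) (l : ℕ) : c k • t ^ l = 0 := by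
  induction l with
  | zero => rw [pow_zero, c_smul_one]
  | succ l ih => rw [pow_succ, c_smul_mul, ht, ih, mul_zero, zero_mul, add_zero]

/-- As `β z = z`, the Leibniz rule gives the anticommutator of `z` and `x² - y²`. -/
lemma c_smul_z_sq : c k • z k ^ 2 = 0 := by
  rw [pow_two, c_smul_mul, c_smul_z, beta_z, z_mul_sq_sub_sq, neg_add_cancel]

lemma c_smul_z_pow_even (n : ℕ) : c k • z k ^ (2 * n) = 0 := by
  rw [pow_mul, c_smul_pow_of_eq_zero k (c_smul_z_sq k)]

lemma c_smul_z_pow_odd (n : ℕ) :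
    c k • z k ^ (2 * n + 1) = (x k ^ 2 - y k ^ 2) * z k ^ (2 * n) := by
  -- Splitting off `z` on the left puts `x² - y²` in front, and `β` fixes the remaining even power.
  rw [pow_succ', c_smul_mul, c_smul_z_pow_even, mul_zero, zero_add, c_smul_z, map_pow, beta_z]

end FominKirillov

end

open FominKirillov

theorem mainTheorem8 (k : Type*) [Field k] [CharZero k] :
    (c k • x k = 0 ∧ c k • y k = 0 ∧ c k • z k = x k ^ 2 - y k ^ 2) ∧
    (∀ v w : E k, c k • (v * w) = v * (c k • w) + (c k • v) * beta k w) ∧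
    (∀ D : E k →ₗ[k] E k, (∀ v w : E k, D (v * w) = v * D w + D v * beta k w) →
      D (x k) = 0 → D (y k) = 0 → D (z k) = x k ^ 2 - y k ^ 2 → ∀ w : E k, D w = c k • w) ∧
    (∀ t : E k, t = x k ∨ t = y k → ∀ l n : ℕ,
      c k • (t ^ l * z k ^ (2 * n)) = 0 ∧
      c k • (t ^ l * z k ^ (2 * n + 1)) = t ^ l * (x k ^ 2 - y k ^ 2) * z k ^ (2 * n)) := by
  refine ⟨⟨c_smul_x k, c_smul_y k, c_smul_z k⟩, c_smul_mul k, fun D hD hx hy hz w => ?_,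
    fun t ht l n => ?_⟩
  · have h : D = actE k := eq_of_skew_derivation hD
      (fun v w => by simpa only [c_smul] using c_smul_mul k v w)
      (by rw [hx, ← c_smul, c_smul_x]) (by rw [hy, ← c_smul, c_smul_y])
      (by rw [hz, ← c_smul, c_smul_z])
    rw [h, c_smul]
  · have hl : c k • t ^ l = 0 := by
      rcases ht with rfl | rfl
      · exact c_smul_pow_of_eq_zero k (c_smul_x k) l
      · exact c_smul_pow_of_eq_zero k (c_smul_y k) l
    constructor
    · rw [c_smul_mul, hl, c_smul_z_pow_even, mul_zero, zero_mul, add_zero]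
    · rw [c_smul_mul, hl, c_smul_z_pow_odd, zero_mul, add_zero, mul_assoc]
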